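/- **Setting.** Let $\Theta$ be a compact metrizable space with a Borel probability measure $\tau$ (for instance a compact Riemannian manifold without boundary with its normalized volume measure). Let $\mathcal M(\Theta)$ be the finite signed Borel measures, with total variation norm $\|\mu\|$. Let $\mathcal F$ be a real Hilbert space, $\Phi\in C^0(\Theta;\mathcal F)$, $\|\Phi\|_\infty=\sup_\theta\|\Phi(\theta)\|$, and let $\bar F(\mu)=\bar G(\mu)+\bar H(\mu)$ with $\bar G(\mu)=R(\int\Phi\,d\mu)$. For $f\in L^1(\tau)$ put $F(f)=\bar F(f\tau)$, $G(f)=\bar G(f\tau)$, $H(f)=\bar H(f\tau)$ and $G'[f](\theta)=\langle\nabla R(\int\Phi f\,d\tau),\Phi(\theta)\rangle$. For an extended-valued function $u$, $\operatorname{dom}u=\{u<+\infty\}$. **(A1)** $R:\mathcal F\to\mathbb R$ is convex and differentiable with Lipschitz gradient, with best Lipschitz constant $\mathrm{Lip}(\nabla R)$, and $\bar H$ is a finite (possibly empty) sum of functions of the following types: the convex indicator ($0$ on the set, $+\infty$ outside) of the probability measures, that of the nonnegative measures, $\mu\mapsto\lambda\|\mu\|$, and the convex indicator of $\{\mu:\lambda\|\mu\|\le1\}$,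 with $\lambda\ge0$ (possibly different in each term). **(A2)** $\eta:\mathbb R\to[0,\infty]$ is lower semicontinuous, strictly convex on its domain, continuously differentiable in $\operatorname{int}(\operatorname{dom}\eta)$, with $\eta'(\operatorname{int}(\operatorname{dom}\eta))=\mathbb R$, and for all $c>0$, $\eta(cx)\asymp\eta(x)$ as $x\to+\infty$. Moreover either $\operatorname{dom}\eta=[0,+\infty[$ and $\eta(1)=\eta'(1)=0$, or $\operatorname{dom}\eta=\mathbb R$, $\eta$ is even and $\eta(0)=\eta'(0)=0$. The Bregman divergence is $D_{\bar\eta}(f,g)=\int D_\eta(f(\theta),g(\theta))\,d\tau(\theta)\in[0,\infty]$ with $D_\eta(a,b)=\eta(a)-\eta(b)-\eta'(b)(a-b)$ for $b\in\operatorname{int}(\operatorname{dom}\eta)$ (equal to $+\infty$ if $a\notin\operatorname{dom}\eta$). If $\operatorname{dom}\eta=[0,+\infty[$, one sets $D_\eta(0,0)=0$ and $D_\eta(a,0)=+\infty$ for $a\neq0$, in accordance with $\eta'(0)=-\infty$; for every other $b\notin\operatorname{int}(\operatorname{dom}\eta)$, $D_\eta(a,b)=+\infty$. **Strong convexity.**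 Assume that for some $p\in[1,2]$ and $\beta\ge0$, for every $K'\ge0$ and all $f,g\in L^1(\tau)$ with $\|f\|_{L^1(\tau)},\|g\|_{L^1(\tau)}\le K'$ and $g\in\operatorname{int}(\operatorname{dom}\eta)$ $\tau$-a.e., $$D_{\bar\eta}(f,g)\ge\tfrac12(K'+\beta)^{p-2}\|f-g\|_{L^1(\tau)}^2$$ (in $[0,\infty]$, with $0^{p-2}=+\infty$ for $p<2$ and $0\cdot\infty=0$). **Algorithms.** Let $f_0\in\operatorname{dom}H$ and $s>0$. PGM: for $k\ge0$, $$f_{k+1}\in\arg\min_{f\in L^1(\tau)}\Big\{G(f_k)+\int G'[f_k](f-f_k)\,d\tau+H(f)+\tfrac1sD_{\bar\eta}(f,f_k)\Big\}.$$ APGM: $h_0=f_0$, $\gamma_0=1$ and, for $k\ge0$, $g_k=(1-\gamma_k)f_k+\gamma_kh_k$, $$h_{k+1}\in\arg\min_{f\in L^1(\tau)}\Big\{G(g_k)+\int G'[g_k](f-g_k)\,d\tau+H(f)+\tfrac{\gamma_k}sD_{\bar\eta}(f,h_k)\Big\},$$ $f_{k+1}=(1-\gamma_k)f_k+\gamma_kh_{k+1}$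 and $\gamma_{k+1}=\frac12\big(\sqrt{\gamma_k^4+4\gamma_k^2}-\gamma_k^2\big)$. **Proposition.** Under the above assumptions, let $f_0\in\operatorname{dom}H$ be such that $f_0\in\operatorname{int}(\operatorname{dom}\eta)$ $\tau$-a.e. and $\eta'(f_0)\in L^\infty(\tau)$, let $K\ge\|f_0\|_{L^1(\tau)}$, and let $0<s\le(K+\beta)^{p-2}\big(\|\Phi\|_\infty^2\,\mathrm{Lip}(\nabla R)\big)^{-1}$ (with $0^{-1}=+\infty$). (i) If $(f_k)$ is generated by PGM and $\sup_k\|f_k\|_{L^1(\tau)}\le K$, then $$F(f_k)-F(f)\le\frac1{sk}D_{\bar\eta}(f,f_0)\qquad\forall f\in L^1(\tau),\ \forall k\ge1.$$ (ii) If $(f_k,g_k,h_k)$ is generated by APGM and $\sup_k\|h_k\|_{L^1(\tau)}\le K$, then $$F(f_k)-F(f)\le\frac4{s(k+1)^2}D_{\bar\eta}(f,f_0)\qquad\forall f\in L^1(\tau),\ \forall k\ge1.$$ Moreover $0<\gamma_k\le1$ and $\gamma_k\le2/(k+2)$ for all $k\ge0$. (The inequalities in (i) and (ii) are understood as $F(f_k)\le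 F(f)+\alpha_kD_{\bar\eta}(f,f_0)$ in $]-\infty,+\infty]$, with $\alpha_k=\frac1{sk}$, resp. $\alpha_k=\frac4{s(k+1)^2}$.) -/

import Mathlib

open MeasureTheory Set Filter
open scoped NNReal ENNReal

noncomputable section

namespace BregmanMethods

/-! ### Objective function -/

section Objective

variable {Θ : Type*} [MeasurableSpace Θ]

/-- The convex indicator of a set: `0` on the set and `+∞` outside of it. -/
def convexIndicator {V : Type*} (C : Set V) (x : V) : ℝ≥0∞ :=
  open Classical in if x ∈ C then 0 else ⊤

/-- The total variation norm of a finite signed measure. -/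
def tvNorm (μ : SignedMeasure Θ) : ℝ≥0∞ := μ.variation univ

/-- The nonnegative finite measures, as a set of signed measures. -/
def nonnegMeasures (Θ : Type*) [MeasurableSpace Θ] : Set (SignedMeasure Θ) := {μ | 0 ≤ μ}

/-- The probability measures, as a set of signed measures. -/
def probMeasures (Θ : Type*) [MeasurableSpace Θ] : Set (SignedMeasure Θ) :=
  {μ | 0 ≤ μ ∧ μ univ = 1}

/-- The admissible regularizers: (finite, possibly empty) sums of indicators of the probability
measures, indicators of the nonnegative measures, multiples `lam * ‖μ‖` of the total variation
norm and indicators of the balls `{μ ; lam * ‖μ‖ ≤ 1}`, with `lam ≥ 0`. -/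
inductive IsRegularizer : (SignedMeasure Θ → ℝ≥0∞) → Prop
  | zero : IsRegularizer (fun _ => 0)
  | prob : IsRegularizer (convexIndicator (probMeasures Θ))
  | nonneg : IsRegularizer (convexIndicator (nonnegMeasures Θ))
  | norm (lam : ℝ≥0) : IsRegularizer (fun μ => lam * tvNorm μ)
  | ball (lam : ℝ≥0) : IsRegularizer (convexIndicator {μ | lam * tvNorm μ ≤ 1})
  | add {H₁ H₂ : SignedMeasure Θ → ℝ≥0∞} (h₁ : IsRegularizer H₁) (h₂ : IsRegularizer H₂) :
      IsRegularizer (fun μ => H₁ μ + H₂ μ)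

/-- The best Lipschitz constant of a Lipschitz function. -/
def lipConst {E E' : Type*} [PseudoEMetricSpace E] [PseudoEMetricSpace E'] (u : E → E') : ℝ≥0 :=
  sInf {L : ℝ≥0 | LipschitzWith L u}

variable {𝓕 : Type*} [NormedAddCommGroup 𝓕] [InnerProductSpace ℝ 𝓕] [CompleteSpace 𝓕]

/-- Assumption on the objective: `R` is convex and differentiable with a Lipschitz gradient and
`Hbar` is an admissible regularizer. (The continuity of `Φ` is part of its type `C(Θ, 𝓕)`.) -/
structure AssumptionA1 (R : 𝓕 → ℝ) (Hbar : SignedMeasure Θ → ℝ≥0∞) : Prop where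
  convex : ConvexOn ℝ univ R
  differentiable : Differentiable ℝ R
  lipschitz : ∃ L : ℝ≥0, LipschitzWith L (gradient R)
  regularizer : IsRegularizer Hbar

variable [TopologicalSpace Θ]

/-- The data-fitting term `μ ↦ R (∫ Φ dμ)` on signed measures. -/
def Gbar (Φ : C(Θ, 𝓕)) (R : 𝓕 → ℝ) (μ : SignedMeasure Θ) : ℝ := R (∫ᵛ θ, Φ θ ∂<•μ)

/-- The differential `μ ↦ (θ ↦ ⟪∇R (∫ Φ dμ), Φ θ⟫)` of `Gbar`. -/
def GbarDeriv (Φ : C(Θ, 𝓕)) (R : 𝓕 → ℝ) (μ : SignedMeasure Θ) (θ : Θ) : ℝ :=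
  inner ℝ (gradient R (∫ᵛ θ', Φ θ' ∂<•μ)) (Φ θ)

/-- The objective on signed measures. -/
def Fbar (Φ : C(Θ, 𝓕)) (R : 𝓕 → ℝ) (Hbar : SignedMeasure Θ → ℝ≥0∞) (μ : SignedMeasure Θ) :
    EReal :=
  (Gbar Φ R μ : EReal) + (Hbar μ : EReal)

variable {τ : Measure Θ}

/-- The signed measure `f τ` with density `f ∈ L¹(τ)`. -/
def densityMeasure (f : Lp ℝ 1 τ) : SignedMeasure Θ := τ.withDensityᵥ f

def G (Φ : C(Θ, 𝓕)) (R : 𝓕 → ℝ) (f : Lp ℝ 1 τ) : ℝ := Gbar Φ R (densityMeasure f)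

def GDeriv (Φ : C(Θ, 𝓕)) (R : 𝓕 → ℝ) (f : Lp ℝ 1 τ) (θ : Θ) : ℝ :=
  GbarDeriv Φ R (densityMeasure f) θ

def H (Hbar : SignedMeasure Θ → ℝ≥0∞) (f : Lp ℝ 1 τ) : ℝ≥0∞ := Hbar (densityMeasure f)

def F (Φ : C(Θ, 𝓕)) (R : 𝓕 → ℝ) (Hbar : SignedMeasure Θ → ℝ≥0∞) (f : Lp ℝ 1 τ) : EReal :=
  Fbar Φ R Hbar (densityMeasure f)

end Objective

/-! ### Bregman divergences -/

/-- The domain of an extended-valued function. -/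
def edom {V : Type*} (u : V → ℝ≥0∞) : Set V := {x | u x < ⊤}

/-- The derivative of `η`, meaningful in the interior of its domain. -/
def etaDeriv (η : ℝ → ℝ≥0∞) : ℝ → ℝ := deriv fun x => (η x).toReal

/-- Assumption on the distance-generating function `η`. -/
structure AssumptionA2 (η : ℝ → ℝ≥0∞) : Prop where
  strictConvex : StrictConvexOn ℝ (edom η) fun x => (η x).toReal
  lsc : LowerSemicontinuous η
  contDiff : ContDiffOn ℝ 1 (fun x => (η x).toReal) (interior (edom η))
  surj : etaDeriv η '' interior (edom η) = univ
  growth : ∀ c : ℝ, 0 < c →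
    (fun x : ℝ => (η (c * x)).toReal) =Θ[atTop] fun x : ℝ => (η x).toReal
  normalization :
    (edom η = Ici 0 ∧ η 1 = 0 ∧ etaDeriv η 1 = 0) ∨
    (edom η = univ ∧ (∀ x, η (-x) = η x) ∧ η 0 = 0 ∧ etaDeriv η 0 = 0)

/-- The pointwise Bregman divergence `η a - η b - η' b * (a - b)`, which is `+∞` when `a` is not in
the domain of `η`. When `b` is not in the interior of the domain, the only case of interest is
`dom η = [0, +∞[` and `b = 0`, where `η' 0 = -∞`: then the divergence is `0` if `a = b` and `+∞`
otherwise. -/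
def bregman (η : ℝ → ℝ≥0∞) (a b : ℝ) : ℝ≥0∞ :=
  open Classical in
  if a ∈ edom η then
    if b ∈ interior (edom η) then
      ENNReal.ofReal ((η a).toReal - (η b).toReal - etaDeriv η b * (a - b))
    else if a = b then 0 else ⊤
  else ⊤

section Algorithms

variable {Θ : Type*} [MeasurableSpace Θ] {τ : Measure Θ}

/-- The Bregman divergence on `L¹(τ)`. -/
def bregmanInt (η : ℝ → ℝ≥0∞) (f g : Lp ℝ 1 τ) : ℝ≥0∞ := ∫⁻ θ, bregman η (f θ) (g θ) ∂τ

/-- `η' ∘ f ∈ L^∞(τ)`: almost everywhere `f` takes values where `η'` is finite, and `η' ∘ f` is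
essentially bounded. -/
def EtaDerivBounded (η : ℝ → ℝ≥0∞) (f : Lp ℝ 1 τ) : Prop :=
  (∀ᵐ θ ∂τ, f θ ∈ interior (edom η)) ∧ ∃ C : ℝ, ∀ᵐ θ ∂τ, |etaDeriv η (f θ)| ≤ C

/-- The strong convexity inequality
`D(f, g) ≥ (K + β) ^ (p - 2) / 2 * ‖f - g‖ ^ 2` whenever `‖f‖, ‖g‖ ≤ K` (norms of `L¹(τ)`);
it is only required when `g` takes values where `η` is differentiable. -/
def StronglyConvexDiv (τ : Measure Θ) (η : ℝ → ℝ≥0∞) (p : ℝ) (β : ℝ≥0) : Prop :=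
  ∀ (K : ℝ≥0) (f g : Lp ℝ 1 τ), ‖f‖ ≤ K → ‖g‖ ≤ K → (∀ᵐ θ ∂τ, g θ ∈ interior (edom η)) →
    ((K + β : ℝ≥0) : ℝ≥0∞) ^ (p - 2) / 2 * ‖f - g‖ₑ ^ 2 ≤ bregmanInt η f g

variable [TopologicalSpace Θ]
  {𝓕 : Type*} [NormedAddCommGroup 𝓕] [InnerProductSpace ℝ 𝓕] [CompleteSpace 𝓕]

/-- The function `f ↦ G g + ∫ G'[g] (f - g) dτ + H f + t * D(f, h)` minimized at each step. -/
def stepObjective (Φ : C(Θ, 𝓕)) (R : 𝓕 → ℝ) (Hbar : SignedMeasure Θ → ℝ≥0∞) (η : ℝ → ℝ≥0∞)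
    (t : ℝ) (g h f : Lp ℝ 1 τ) : EReal :=
  ((G Φ R g + ∫ θ, GDeriv Φ R g θ * (f θ - g θ) ∂τ : ℝ) : EReal) + (H Hbar f : EReal)
    + ((ENNReal.ofReal t * bregmanInt η f h : ℝ≥0∞) : EReal)

/-- `f` is a sequence of iterates of the proximal gradient method with step size `s`. -/
structure IsPGM (Φ : C(Θ, 𝓕)) (R : 𝓕 → ℝ) (Hbar : SignedMeasure Θ → ℝ≥0∞) (η : ℝ → ℝ≥0∞)
    (s : ℝ) (f₀ : Lp ℝ 1 τ) (f : ℕ → Lp ℝ 1 τ) : Prop where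
  init : f 0 = f₀
  step : ∀ k, IsMinOn (stepObjective Φ R Hbar η (1 / s) (f k) (f k)) univ (f (k + 1))

/-- The coefficients `γ_k` of the accelerated method. -/
def gam : ℕ → ℝ
  | 0 => 1
  | k + 1 => (1 / 2) * (√(gam k ^ 4 + 4 * gam k ^ 2) - gam k ^ 2)

/-- `(f, g, h)` are iterates of the accelerated proximal gradient method with step size `s`. -/
structure IsAPGM (Φ : C(Θ, 𝓕)) (R : 𝓕 → ℝ) (Hbar : SignedMeasure Θ → ℝ≥0∞) (η : ℝ → ℝ≥0∞)
    (s : ℝ) (f₀ : Lp ℝ 1 τ) (f g h : ℕ → Lp ℝ 1 τ) : Prop where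
  init_f : f 0 = f₀
  init_h : h 0 = f₀
  step_g : ∀ k, g k = (1 - gam k) • f k + gam k • h k
  step_h : ∀ k, IsMinOn (stepObjective Φ R Hbar η (gam k / s) (g k) (h k)) univ (h (k + 1))
  step_f : ∀ k, f (k + 1) = (1 - gam k) • f k + gam k • h (k + 1)

end Algorithms

end BregmanMethods

end

open BregmanMethods

/-! Everything rests on `three_point`: for a minimizer x of the step objective and a competitor u,
the gap between the two values dominates t·D(u, x). No optimality system is written. The minimizer
is compared with (1-ε)x + εu: the linearization is affine, H is convex, and `bregman_convex_comb`
expresses the convexity defect of D(·, z) exactly through η, with no trace of z. Dividing by ε and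
letting ε → 0, this defect tends to the integrand of D(u, x) (`tendsto_convexityDefect`), and
Fatou's lemma concludes, even where x touches the boundary of dom η.

Taking u = f₀ propagates finiteness of D(f₀, ·), which keeps the Bregman centres in the interior of
dom η almost everywhere, so the strong convexity assumption applies to them. The quadratic error of
`G_le_linearization` is then absorbed by the divergence (`sq_norm_sub_le_bregmanInt`). The one-step
inequalities telescope: for PGM by monotonicity of the objective, for APGM by γ_{k+1}² =
(1-γ_{k+1})γ_k². -/

noncomputable section

namespace BregmanMethods

set_option linter.unusedSectionVars false

/-! ### Convexity of the admissible regularizers -/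

section Regularizer

variable {Θ : Type*} [MeasurableSpace Θ]

lemma convexIndicator_convex_comb {V : Type*} [AddCommGroup V] [Module ℝ V] {C : Set V}
    (hC : Convex ℝ C) (x y : V) {a b : ℝ} (ha : 0 < a) (hb : 0 < b) (hab : a + b = 1) :
    convexIndicator C (a • x + b • y)
      ≤ ENNReal.ofReal a * convexIndicator C x + ENNReal.ofReal b * convexIndicator C y := by
  by_cases hx : x ∈ C
  · by_cases hy : y ∈ C
    · simp [convexIndicator, hx, hy, hC hx hy ha.le hb.le hab]
    · simp [convexIndicator, hy, ENNReal.mul_top, hb]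
  · simp [convexIndicator, hx, ENNReal.mul_top, ha]

lemma tvNorm_convex_comb (μ ν : SignedMeasure Θ) {a b : ℝ} (ha : 0 < a) (hb : 0 < b) :
    tvNorm (a • μ + b • ν) ≤ ENNReal.ofReal a * tvNorm μ + ENNReal.ofReal b * tvNorm ν := by
  have key : ∀ {c : ℝ}, 0 < c → ∀ m : SignedMeasure Θ,
      (c • m).variation univ = ENNReal.ofReal c * m.variation univ := by
    intro c hc m
    rw [VectorMeasure.variation_smul, Measure.smul_apply, ENNReal.smul_def, smul_eq_mul,
      ENNReal.ofReal, Real.toNNReal_of_nonneg hc.le]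
    congr 2
    ext
    simp [abs_of_pos hc]
  calc tvNorm (a • μ + b • ν) ≤ ((a • μ).variation + (b • ν).variation) univ :=
        VectorMeasure.variation_add_le univ
    _ = _ := by rw [Measure.add_apply, key ha, key hb]; rfl

lemma convex_nonnegMeasures : Convex ℝ (nonnegMeasures Θ) := by
  intro μ hμ ν hν a b ha hb _ s hs
  have h1 := hμ s hs
  have h2 := hν s hs
  simp only [FunLike.coe_zero, Pi.zero_apply, FunLike.coe_add, FunLike.coe_smul,
    Pi.add_apply, Pi.smul_apply, smul_eq_mul] at *
  positivity

lemma convex_probMeasures : Convex ℝ (probMeasures Θ) := by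
  intro μ hμ ν hν a b ha hb hab
  refine ⟨convex_nonnegMeasures hμ.1 hν.1 ha hb hab, ?_⟩
  simp [hμ.2, hν.2, hab]

lemma convex_ball (lam : ℝ≥0) : Convex ℝ {μ : SignedMeasure Θ | lam * tvNorm μ ≤ 1} := by
  rw [convex_iff_forall_pos]
  intro μ hμ ν hν a b ha hb hab
  simp only [mem_ofPred_eq] at *
  calc (lam : ℝ≥0∞) * tvNorm (a • μ + b • ν)
      ≤ lam * (ENNReal.ofReal a * tvNorm μ + ENNReal.ofReal b * tvNorm ν) := by
        gcongr; exact tvNorm_convex_comb μ ν ha hb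
    _ = ENNReal.ofReal a * (lam * tvNorm μ) + ENNReal.ofReal b * (lam * tvNorm ν) := by ring
    _ ≤ ENNReal.ofReal a * 1 + ENNReal.ofReal b * 1 := by gcongr
    _ = 1 := by rw [mul_one, mul_one, ← ENNReal.ofReal_add ha.le hb.le, hab, ENNReal.ofReal_one]

lemma IsRegularizer.convex_comb {Hbar : SignedMeasure Θ → ℝ≥0∞} (h : IsRegularizer Hbar)
    (μ ν : SignedMeasure Θ) {a b : ℝ} (ha : 0 < a) (hb : 0 < b) (hab : a + b = 1) :
    Hbar (a • μ + b • ν) ≤ ENNReal.ofReal a * Hbar μ + ENNReal.ofReal b * Hbar ν := by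
  induction h with
  | zero => simp
  | prob => exact convexIndicator_convex_comb convex_probMeasures _ _ ha hb hab
  | nonneg => exact convexIndicator_convex_comb convex_nonnegMeasures _ _ ha hb hab
  | norm lam =>
    calc (lam : ℝ≥0∞) * tvNorm (a • μ + b • ν)
        ≤ lam * (ENNReal.ofReal a * tvNorm μ + ENNReal.ofReal b * tvNorm ν) := by
          gcongr
          exact tvNorm_convex_comb μ ν ha hb
      _ = ENNReal.ofReal a * (lam * tvNorm μ) + ENNReal.ofReal b * (lam * tvNorm ν) := by ring
  | ball lam => exact convexIndicator_convex_comb (convex_ball lam) _ _ ha hb hab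
  | @add H₁ H₂ _ _ ih₁ ih₂ =>
    calc H₁ (a • μ + b • ν) + H₂ (a • μ + b • ν) ≤ _ := add_le_add ih₁ ih₂
      _ = ENNReal.ofReal a * (H₁ μ + H₂ μ) + ENNReal.ofReal b * (H₁ ν + H₂ ν) := by ring

end Regularizer

/-! ### Transfer of convexity to densities -/

section Density

variable {Θ : Type*} [MeasurableSpace Θ] {τ : Measure Θ}

lemma densityMeasure_convex_comb (f g : Lp ℝ 1 τ) (a b : ℝ) :
    densityMeasure (a • f + b • g) = a • densityMeasure f + b • densityMeasure g := by
  have hf := L1.integrable_coeFn f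
  have hg := L1.integrable_coeFn g
  have h : (a • f + b • g : Lp ℝ 1 τ) =ᵐ[τ] a • (f : Θ → ℝ) + b • (g : Θ → ℝ) := by
    filter_upwards [Lp.coeFn_add (a • f) (b • g), Lp.coeFn_smul a f, Lp.coeFn_smul b g]
      with θ h1 h2 h3
    rw [h1, Pi.add_apply, h2, h3, Pi.add_apply]
  unfold densityMeasure
  rw [(L1.integrable_coeFn _).withDensityᵥ_eq_iff ((hf.smul a).add (hg.smul b)) |>.2 h,
    withDensityᵥ_add (hf.smul a) (hg.smul b), withDensityᵥ_smul, withDensityᵥ_smul]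

lemma H_convex_comb {Hbar : SignedMeasure Θ → ℝ≥0∞} (h : IsRegularizer Hbar) (f g : Lp ℝ 1 τ)
    {a b : ℝ} (ha : 0 < a) (hb : 0 < b) (hab : a + b = 1) :
    H Hbar (a • f + b • g) ≤ ENNReal.ofReal a * H Hbar f + ENNReal.ofReal b * H Hbar g := by
  rw [H, densityMeasure_convex_comb]
  exact h.convex_comb _ _ ha hb hab

end Density

/-! ### First-order bounds for smooth convex functions -/

section Smooth

variable {E : Type*} [NormedAddCommGroup E] [InnerProductSpace ℝ E] [CompleteSpace E]

/-- The infimum is attained: each ratio of distances is a lower bound of the set of Lipschitz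
constants. Nonemptiness matters, since `sInf ∅ = 0` in `ℝ≥0`. -/
lemma lipschitzWith_lipConst {X Y : Type*} [PseudoMetricSpace X] [PseudoMetricSpace Y] {u : X → Y}
    (h : ∃ L : ℝ≥0, LipschitzWith L u) : LipschitzWith (lipConst u) u := by
  refine LipschitzWith.of_dist_le_mul fun x y => ?_
  obtain ⟨L₀, hL₀⟩ := h
  rcases (dist_nonneg (x := x) (y := y)).eq_or_lt' with h0 | hpos
  · simpa [h0] using hL₀.dist_le_mul x y
  · rw [← div_le_iff₀ hpos]
    rw [← Real.toNNReal_le_iff_le_coe]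
    refine le_csInf (show {L : ℝ≥0 | LipschitzWith L u}.Nonempty from ⟨L₀, hL₀⟩) fun L hL => ?_
    rw [Real.toNNReal_le_iff_le_coe]
    exact (div_le_iff₀ hpos).2 (LipschitzWith.dist_le_mul hL x y)

lemma hasDerivAt_comp_line {R : E → ℝ} (hR : Differentiable ℝ R) (x v : E) (t : ℝ) :
    HasDerivAt (fun t : ℝ => R (x + t • v)) (inner ℝ (gradient R (x + t • v)) v) t := by
  have h1 : HasDerivAt (fun t : ℝ => x + t • v) v t := by
    simpa using ((hasDerivAt_id t).smul_const v).const_add x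
  have := (hR (x + t • v)).hasFDerivAt.comp_hasDerivAt t h1
  rwa [inner_gradient_left]

lemma le_of_convexOn_gradient {R : E → ℝ} (hc : ConvexOn ℝ univ R) (hR : Differentiable ℝ R)
    (x y : E) : R x + inner ℝ (gradient R x) (y - x) ≤ R y := by
  have hc' : ConvexOn ℝ univ (fun t : ℝ => R (x + t • (y - x))) := by
    have := hc.comp_affineMap (AffineMap.lineMap x y : ℝ →ᵃ[ℝ] E)
    refine this.congr fun t _ => ?_
    simp [AffineMap.lineMap_apply, add_comm]
  have h := hc'.le_slope_of_hasDerivAt (mem_univ 0) (mem_univ 1) one_pos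
    (hasDerivAt_comp_line hR x (y - x) 0)
  simp only [slope_def_field, zero_smul, add_zero, one_smul, add_sub_cancel, sub_zero, div_one] at h
  linarith

/-- Subtracting the tangent and t²L‖v‖²/2 from R along the segment leaves an antitone function on
[0, 1], so no integral remainder is needed. -/
lemma le_of_lipschitzWith_gradient {R : E → ℝ} (hR : Differentiable ℝ R) {L : ℝ≥0}
    (hL : LipschitzWith L (gradient R)) (x y : E) :
    R y ≤ R x + inner ℝ (gradient R x) (y - x) + L / 2 * ‖y - x‖ ^ 2 := by
  set v := y - x with hv
  have hd : ∀ t : ℝ, HasDerivAt (fun t : ℝ => R (x + t • v) - t * inner ℝ (gradient R x) v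
      - t ^ 2 * (L / 2 * ‖v‖ ^ 2))
      (inner ℝ (gradient R (x + t • v)) v - inner ℝ (gradient R x) v - 2 * t * (L / 2 * ‖v‖ ^ 2))
      t := by
    intro t
    have h2 := (hasDerivAt_id t).mul_const (inner ℝ (gradient R x) v)
    have h3 := (hasDerivAt_pow 2 t).mul_const (L / 2 * ‖v‖ ^ 2 : ℝ)
    convert! ((hasDerivAt_comp_line hR x v t).sub h2).sub h3 using 1
    simp
  have hanti := antitoneOn_of_deriv_nonpos (convex_Icc (0 : ℝ) 1)
    (fun t _ => (hd t).continuousAt.continuousWithinAt)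
    (fun t _ => (hd t).differentiableAt.differentiableWithinAt) (fun t ht => by
      rw [interior_Icc] at ht
      rw [(hd t).deriv, ← inner_sub_left]
      have h1 := real_inner_le_norm (gradient R (x + t • v) - gradient R x) v
      have h2 : ‖gradient R (x + t • v) - gradient R x‖ ≤ L * (t * ‖v‖) := by
        simpa [dist_eq_norm, norm_smul, abs_of_pos ht.1] using hL.dist_le_mul (x + t • v) x
      nlinarith [mul_le_mul_of_nonneg_right h2 (norm_nonneg v)])
  have := hanti (left_mem_Icc.2 zero_le_one) (right_mem_Icc.2 zero_le_one) zero_le_one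
  simp only [hv, zero_smul, add_zero, one_smul, add_sub_cancel] at this ⊢
  linarith

end Smooth

/-! ### The data-fitting term through the moments ∫ f Φ dτ -/

section DataFitting

variable {Θ : Type*} [MeasurableSpace Θ] {τ : Measure Θ}
  {𝓕 : Type*} [NormedAddCommGroup 𝓕] [InnerProductSpace ℝ 𝓕] [CompleteSpace 𝓕]

lemma integral_toSignedMeasure_withDensity {φ : Θ → 𝓕} (f : Θ → ℝ) (hf : Integrable f τ)
    [IsFiniteMeasure (τ.withDensity fun θ => ENNReal.ofReal (f θ))] :
    ∫ᵛ θ, φ θ ∂<•(τ.withDensity fun θ => ENNReal.ofReal (f θ)).toSignedMeasure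
      = ∫ θ, max (f θ) 0 • φ θ ∂τ := by
  rw [VectorMeasure.integral_toSignedMeasure,
    integral_withDensity_eq_integral_toReal_smul₀ hf.aemeasurable.ennreal_ofReal (by simp)]
  refine integral_congr_ae (ae_of_all _ fun θ => ?_)
  simp only [ENNReal.toReal_ofReal']

lemma integrable_withDensity_ofReal {φ : Θ → 𝓕} {C : ℝ} (hφ : StronglyMeasurable φ)
    (hC : ∀ θ, ‖φ θ‖ ≤ C) (f : Θ → ℝ)
    [IsFiniteMeasure (τ.withDensity fun θ => ENNReal.ofReal (f θ))] :
    (τ.withDensity fun θ => ENNReal.ofReal (f θ)).toSignedMeasure.Integrable φ := by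
  rw [VectorMeasure.Integrable, Measure.variation_toSignedMeasure]
  exact Integrable.of_bound hφ.aestronglyMeasurable C (ae_of_all _ hC)

/-- Integration against the measure with density `f` is integration of `f • φ`. -/
lemma integral_densityMeasure {φ : Θ → 𝓕} {C : ℝ} (hφ : StronglyMeasurable φ)
    (hC : ∀ θ, ‖φ θ‖ ≤ C) (f : Lp ℝ 1 τ) :
    ∫ᵛ θ, φ θ ∂<•(densityMeasure f) = ∫ θ, f θ • φ θ ∂τ := by
  have hf := L1.integrable_coeFn f
  have : IsFiniteMeasure (τ.withDensity fun θ => ENNReal.ofReal (f θ)) :=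
    isFiniteMeasure_withDensity_ofReal hf.2
  have : IsFiniteMeasure (τ.withDensity fun θ => ENNReal.ofReal (-f θ)) :=
    isFiniteMeasure_withDensity_ofReal hf.neg.2
  -- Splitting f = f⁺ - f⁻ reduces the signed integral to two integrals against positive measures.
  rw [densityMeasure, withDensityᵥ_eq_withDensity_pos_part_sub_withDensity_neg_part hf,
    VectorMeasure.integral_sub_vectorMeasure (integrable_withDensity_ofReal hφ hC _)
      (integrable_withDensity_ofReal hφ hC _),
    integral_toSignedMeasure_withDensity _ hf,
    integral_toSignedMeasure_withDensity (fun θ => -f θ) hf.neg, ← integral_sub]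
  · refine integral_congr_ae (ae_of_all _ fun θ => ?_)
    simp only [← sub_smul]
    congr 1
    exact posPart_sub_negPart (f θ)
  · exact hf.pos_part.smul_bdd C hφ.aestronglyMeasurable (ae_of_all _ hC)
  · exact hf.neg_part.smul_bdd C hφ.aestronglyMeasurable (ae_of_all _ hC)

section Compact

variable [TopologicalSpace Θ] [CompactSpace Θ] [TopologicalSpace.MetrizableSpace Θ] [BorelSpace Θ]
  (Φ : C(Θ, 𝓕)) (R : 𝓕 → ℝ)

/-- The linear measurement `∫ f Φ dτ` of a density `f`. -/
def moment (f : Lp ℝ 1 τ) : 𝓕 := ∫ θ, f θ • Φ θ ∂τ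

lemma stronglyMeasurable_feature : StronglyMeasurable Φ := by
  let := TopologicalSpace.metrizableSpaceMetric Θ
  exact Φ.continuous.stronglyMeasurable

lemma integrable_smul_feature (f : Lp ℝ 1 τ) : Integrable (fun θ => f θ • Φ θ) τ :=
  (L1.integrable_coeFn f).smul_bdd ‖Φ‖ (stronglyMeasurable_feature Φ).aestronglyMeasurable
    (ae_of_all _ Φ.norm_coe_le_norm)

lemma integral_feature_densityMeasure (f : Lp ℝ 1 τ) :
    ∫ᵛ θ, Φ θ ∂<•(densityMeasure f) = moment Φ f :=
  integral_densityMeasure (stronglyMeasurable_feature Φ) Φ.norm_coe_le_norm f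

lemma G_eq (f : Lp ℝ 1 τ) : G Φ R f = R (moment Φ f) := by
  rw [G, Gbar, integral_feature_densityMeasure]

lemma moment_convex_comb (f g : Lp ℝ 1 τ) (a b : ℝ) :
    moment Φ (a • f + b • g) = a • moment Φ f + b • moment Φ g := by
  simp only [moment]
  rw [← integral_smul, ← integral_smul]
  refine Eq.trans ?_ (integral_add ((integrable_smul_feature Φ f).smul a)
    ((integrable_smul_feature Φ g).smul b))
  refine integral_congr_ae ?_
  filter_upwards [Lp.coeFn_add (a • f) (b • g), Lp.coeFn_smul a f, Lp.coeFn_smul b g]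
    with θ h1 h2 h3
  rw [h1, Pi.add_apply, h2, h3]
  simp [add_smul, mul_smul]

lemma moment_sub (f g : Lp ℝ 1 τ) : moment Φ (f - g) = moment Φ f - moment Φ g := by
  have := moment_convex_comb Φ f g 1 (-1)
  simpa [sub_eq_add_neg] using this

lemma norm_moment_le (f : Lp ℝ 1 τ) : ‖moment Φ f‖ ≤ ‖Φ‖ * ‖f‖ := by
  rw [L1.norm_eq_integral_norm, ← integral_const_mul]
  refine norm_integral_le_of_norm_le ((L1.integrable_coeFn f).norm.const_mul _)
    (ae_of_all _ fun θ => ?_)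
  rw [norm_smul, mul_comm]
  gcongr
  exact Φ.norm_coe_le_norm θ

/-- The linearization of `G` at `g`. -/
def linearization (g f : Lp ℝ 1 τ) : ℝ :=
  R (moment Φ g) + inner ℝ (gradient R (moment Φ g)) (moment Φ f - moment Φ g)

lemma G_add_integral_GDeriv (g f : Lp ℝ 1 τ) :
    G Φ R g + ∫ θ, GDeriv Φ R g θ * (f θ - g θ) ∂τ = linearization Φ R g f := by
  rw [linearization, G_eq, ← moment_sub, show moment Φ (f - g) = ∫ θ, (f - g : Lp ℝ 1 τ) θ • Φ θ ∂τ from rfl,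
    ← integral_inner (integrable_smul_feature Φ _)]
  congr 1
  refine integral_congr_ae ?_
  filter_upwards [Lp.coeFn_sub f g] with θ h
  rw [GDeriv, GbarDeriv, integral_feature_densityMeasure, h, Pi.sub_apply, real_inner_smul_right,
    mul_comm]

lemma linearization_convex_comb (g u v : Lp ℝ 1 τ) {a b : ℝ} (hab : a + b = 1) :
    linearization Φ R g (a • u + b • v) =
      a * linearization Φ R g u + b * linearization Φ R g v := by
  obtain rfl : b = 1 - a := by linarith
  simp only [linearization, moment_convex_comb, inner_sub_right, inner_add_right,
    real_inner_smul_right]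
  ring

variable {R}

lemma linearization_le (hc : ConvexOn ℝ univ R) (hR : Differentiable ℝ R) (g f : Lp ℝ 1 τ) :
    linearization Φ R g f ≤ G Φ R f := by
  rw [G_eq]
  exact le_of_convexOn_gradient hc hR _ _

/-- Descent lemma for R, pulled back by the moment map, whose operator norm is at most ‖Φ‖. -/
lemma G_le_linearization (hR : Differentiable ℝ R) (hL : ∃ L : ℝ≥0, LipschitzWith L (gradient R))
    (g f : Lp ℝ 1 τ) :
    G Φ R f ≤ linearization Φ R g f + ‖Φ‖ ^ 2 * lipConst (gradient R) / 2 * ‖f - g‖ ^ 2 := by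
  rw [G_eq]
  refine (le_of_lipschitzWith_gradient hR (lipschitzWith_lipConst hL) (moment Φ g) _).trans ?_
  rw [linearization, ← moment_sub]
  have h := pow_le_pow_left₀ (norm_nonneg _) (norm_moment_le Φ (f - g)) 2
  have h' := mul_le_mul_of_nonneg_left h (show (0 : ℝ) ≤ lipConst (gradient R) / 2 by positivity)
  linarith

end Compact

end DataFitting

/-! ### Pointwise Bregman divergence and its convexity defect -/

section Bregman

lemma add_mul_sub_le_of_convexOn {S : Set ℝ} {f : ℝ → ℝ} {x y f' : ℝ} (hf : ConvexOn ℝ S f)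
    (hx : x ∈ S) (hy : y ∈ S) (hd : HasDerivAt f f' x) : f x + f' * (y - x) ≤ f y := by
  rcases lt_trichotomy x y with h | rfl | h
  · have := hf.le_slope_of_hasDerivAt hx hy h hd
    rw [slope_def_field, le_div_iff₀ (sub_pos.2 h)] at this
    linarith
  · simp
  · have := hf.slope_le_of_hasDerivAt hy hx h hd
    rw [slope_def_field, div_le_iff₀ (sub_pos.2 h)] at this
    linarith

variable {η : ℝ → ℝ≥0∞}

namespace AssumptionA2

lemma hasDerivAt (h : AssumptionA2 η) {b : ℝ} (hb : b ∈ interior (edom η)) :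
    HasDerivAt (fun x => (η x).toReal) (etaDeriv η b) b :=
  ((h.contDiff.differentiableOn one_ne_zero).differentiableAt
    (isOpen_interior.mem_nhds hb)).hasDerivAt

lemma tangent_le (h : AssumptionA2 η) {a b : ℝ} (ha : a ∈ edom η) (hb : b ∈ interior (edom η)) :
    (η b).toReal + etaDeriv η b * (a - b) ≤ (η a).toReal :=
  add_mul_sub_le_of_convexOn h.strictConvex.convexOn (interior_subset hb) ha (h.hasDerivAt hb)

lemma eq_zero_of_notMem_interior (h : AssumptionA2 η) {b : ℝ} (hb : b ∈ edom η)
    (hb' : b ∉ interior (edom η)) : edom η = Ici 0 ∧ b = 0 := by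
  rcases h.normalization with ⟨hd, -⟩ | ⟨hd, -⟩
  · rw [hd, interior_Ici, mem_Ioi, not_lt] at hb'
    rw [hd] at hb
    exact ⟨hd, le_antisymm hb' hb⟩
  · simp [hd] at hb'

lemma measurable (h : AssumptionA2 η) : Measurable η := h.lsc.measurable

end AssumptionA2

lemma measurable_bregman (h : AssumptionA2 η) :
    Measurable fun q : ℝ × ℝ => bregman η q.1 q.2 := by
  have hd : MeasurableSet (edom η) := h.measurable measurableSet_Iio
  have hη := h.measurable
  have hη' : Measurable (etaDeriv η) := measurable_deriv _
  unfold bregman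
  refine Measurable.ite (measurable_fst hd) (Measurable.ite
    (measurable_snd isOpen_interior.measurableSet) ?_ (Measurable.ite
      (measurableSet_eq_fun measurable_fst measurable_snd) measurable_const measurable_const))
    measurable_const
  fun_prop

lemma mem_edom_of_bregman_ne_top {a b : ℝ} (h : bregman η a b ≠ ⊤) : a ∈ edom η := by
  by_contra ha
  simp [bregman, ha] at h

lemma eq_of_bregman_ne_top {a b : ℝ} (h : bregman η a b ≠ ⊤) (hb : b ∉ interior (edom η)) :
    a = b := by
  by_contra hab
  simp [bregman, hb, hab] at h

lemma bregman_self (a : ℝ) (ha : a ∈ edom η) : bregman η a a = 0 := by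
  simp [bregman, ha]

/-- The convexity defect of `η` on the segment from `x` to `u`. -/
def convexityDefect (η : ℝ → ℝ≥0∞) (ε u x : ℝ) : ℝ≥0∞ :=
  ENNReal.ofReal ((η u).toReal - (η x).toReal
    - ((η ((1 - ε) * x + ε * u)).toReal - (η x).toReal) / ε)

lemma measurable_convexityDefect (h : AssumptionA2 η) (ε : ℝ) :
    Measurable fun q : ℝ × ℝ => convexityDefect η ε q.1 q.2 := by
  have hη := h.measurable
  unfold convexityDefect
  fun_prop

/-- D(·, z) differs from η by an affine function, which cancels in the defect; hence an equality,
and a defect free of z. -/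
lemma bregman_convex_comb (h : AssumptionA2 η) {u x z ε : ℝ} (hu : bregman η u z ≠ ⊤)
    (hx : bregman η x z ≠ ⊤) (hε : 0 < ε) (hε' : ε < 1) :
    ENNReal.ofReal ε * bregman η u z + ENNReal.ofReal (1 - ε) * bregman η x z =
      bregman η ((1 - ε) * x + ε * u) z + ENNReal.ofReal ε * convexityDefect η ε u x := by
  have hud := mem_edom_of_bregman_ne_top hu
  have hxd := mem_edom_of_bregman_ne_top hx
  have hε1 : 0 < 1 - ε := by linarith
  have hmd : (1 - ε) * x + ε * u ∈ edom η :=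
    h.strictConvex.1 hxd hud hε1.le hε.le (by ring)
  by_cases hz : z ∈ interior (edom η)
  · have t1 := h.tangent_le hud hz
    have t2 := h.tangent_le hxd hz
    have t3 := h.tangent_le hmd hz
    have t4 := h.strictConvex.convexOn.2 hxd hud hε1.le hε.le (by ring)
    simp only [smul_eq_mul] at t4
    have t5 : 0 ≤ (η u).toReal - (η x).toReal
        - ((η ((1 - ε) * x + ε * u)).toReal - (η x).toReal) / ε := by
      rw [sub_nonneg, div_le_iff₀ hε]
      linarith
    simp only [bregman, hud, hxd, hmd, hz, if_true, convexityDefect]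
    rw [← ENNReal.ofReal_mul hε.le, ← ENNReal.ofReal_mul hε1.le, ← ENNReal.ofReal_mul hε.le,
      ← ENNReal.ofReal_add, ← ENNReal.ofReal_add]
    · congr 1
      field_simp
      ring
    · linarith
    · positivity
    · exact mul_nonneg hε.le (by linarith)
    · exact mul_nonneg hε1.le (by linarith)
  -- Outside the interior, finiteness forces u = x = z and all terms vanish.
  · obtain rfl := eq_of_bregman_ne_top hu hz
    obtain rfl := eq_of_bregman_ne_top hx hz
    have hm : (1 - ε) * x + ε * x = x := by ring
    simp [hm, bregman_self x hxd, convexityDefect]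

/-- This is η'(0) = -∞, extracted from surjectivity of η': a point y with very negative η'(y) has,
by its tangent evaluated at 0, a very negative chord from 0, and convexity makes shorter chords
steeper still. -/
lemma tendsto_slope_atBot_of_boundary (h : AssumptionA2 η) (hd : edom η = Ici 0) {u : ℝ}
    (hu : 0 < u) :
    Tendsto (fun ε : ℝ => ((η (ε * u)).toReal - (η 0).toReal) / ε) (nhdsWithin 0 (Ioi 0)) atBot := by
  rw [tendsto_atBot]
  intro M
  obtain ⟨y, hy, hyM⟩ : M / u ∈ etaDeriv η '' interior (edom η) := by rw [h.surj]; trivial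
  have h0 : (0 : ℝ) ∈ edom η := by simp [hd]
  have ht := h.tangent_le h0 hy
  have hy0 : 0 < y := by simpa [hd] using hy
  rw [hyM] at ht
  filter_upwards [Ioo_mem_nhdsGT (div_pos hy0 hu)] with ε hε
  rw [div_le_iff₀ hε.1]
  have h1 : ε * u < y := (lt_div_iff₀ hu).1 hε.2
  have hr0 : 0 ≤ ε * u / y := div_nonneg (mul_nonneg hε.1.le hu.le) hy0.le
  have hr1 : 0 ≤ 1 - ε * u / y := sub_nonneg.2 ((div_le_one hy0).2 h1.le)
  have hc := h.strictConvex.convexOn.2 h0 (interior_subset hy) hr1 hr0 (by ring)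
  simp only [smul_eq_mul, mul_zero, zero_add, div_mul_cancel₀ _ hy0.ne'] at hc
  have h2 : ε * u / y * ((η y).toReal - (η 0).toReal) ≤ ε * u / y * (M / u * y) := by
    gcongr
    linarith
  have h3 : ε * u / y * (M / u * y) = M * ε := by field_simp
  linarith

/-- In the interior this is the derivative of η along the segment. At the boundary x = 0 the limit
is +∞ for u > 0 and 0 for u = 0, exactly the convention in `bregman`. -/
lemma tendsto_convexityDefect (h : AssumptionA2 η) {u x : ℝ} (hu : u ∈ edom η)
    (hx : x ∈ edom η) :
    Tendsto (fun ε => convexityDefect η ε u x) (nhdsWithin 0 (Ioi 0)) (nhds (bregman η u x)) := by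
  by_cases hxi : x ∈ interior (edom η)
  · simp only [bregman, hu, hxi, if_true, convexityDefect]
    refine ENNReal.tendsto_ofReal (tendsto_const_nhds.sub ?_)
    have h1 : HasDerivAt (fun ε : ℝ => (1 - ε) * x + ε * u) (u - x) 0 := by
      have := (((hasDerivAt_id (0 : ℝ)).const_sub 1).mul_const x).add
        ((hasDerivAt_id (0 : ℝ)).mul_const u)
      convert! this using 1
      ring
    have h2 : HasDerivAt (fun ε : ℝ => (η ((1 - ε) * x + ε * u)).toReal)
        (etaDeriv η x * (u - x)) 0 :=
      HasDerivAt.comp (h₂ := fun x => (η x).toReal) 0 (by simpa using h.hasDerivAt hxi) h1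
    have h3 := h2.tendsto_slope_zero_right
    refine h3.congr fun ε => ?_
    simp [div_eq_inv_mul]
  · obtain ⟨hd, rfl⟩ := h.eq_zero_of_notMem_interior hx hxi
    rcases eq_or_ne u 0 with rfl | hu0
    · simp [bregman_self 0 hx, convexityDefect]
    · have hupos : 0 < u := lt_of_le_of_ne (by simpa [hd] using hu) hu0.symm
      simp only [bregman, hu, hxi, hu0, if_true, if_false, convexityDefect, mul_zero, zero_add]
      refine ENNReal.tendsto_ofReal_atTop.comp ?_
      simp only [sub_eq_add_neg _ (_ / _)]
      exact tendsto_atTop_add_const_left _ _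
        (tendsto_neg_atBot_atTop.comp (tendsto_slope_atBot_of_boundary h hd hupos))

end Bregman

/-! ### Integrated divergence -/

section BregmanInt

variable {Θ : Type*} [MeasurableSpace Θ] {τ : Measure Θ} {η : ℝ → ℝ≥0∞}

lemma measurable_bregman_comp (h : AssumptionA2 η) (f g : Lp ℝ 1 τ) :
    Measurable fun θ => bregman η (f θ) (g θ) :=
  (measurable_bregman h).comp
    ((Lp.stronglyMeasurable f).measurable.prodMk (Lp.stronglyMeasurable g).measurable)

lemma measurable_convexityDefect_comp (h : AssumptionA2 η) (ε : ℝ) (f g : Lp ℝ 1 τ) :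
    Measurable fun θ => convexityDefect η ε (f θ) (g θ) :=
  (measurable_convexityDefect h ε).comp (f := fun θ => (f θ, g θ))
    ((Lp.stronglyMeasurable f).measurable.prodMk (Lp.stronglyMeasurable g).measurable)

lemma ae_bregman_ne_top (h : AssumptionA2 η) {f g : Lp ℝ 1 τ} (hfg : bregmanInt η f g ≠ ⊤) :
    ∀ᵐ θ ∂τ, bregman η (f θ) (g θ) ≠ ⊤ := by
  filter_upwards [ae_lt_top (measurable_bregman_comp h f g) hfg] with θ hθ using hθ.ne

lemma bregmanInt_self {f : Lp ℝ 1 τ} (hf : ∀ᵐ θ ∂τ, f θ ∈ edom η) : bregmanInt η f f = 0 := by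
  rw [bregmanInt, ← lintegral_zero (μ := τ)]
  exact lintegral_congr_ae (by filter_upwards [hf] with θ hθ using bregman_self _ hθ)

lemma bregmanInt_convex_comb (h : AssumptionA2 η) {u x z : Lp ℝ 1 τ}
    (hu : bregmanInt η u z ≠ ⊤) (hx : bregmanInt η x z ≠ ⊤) {ε : ℝ} (hε : 0 < ε) (hε' : ε < 1) :
    ENNReal.ofReal ε * bregmanInt η u z + ENNReal.ofReal (1 - ε) * bregmanInt η x z =
      bregmanInt η ((1 - ε) • x + ε • u) z
        + ENNReal.ofReal ε * ∫⁻ θ, convexityDefect η ε (u θ) (x θ) ∂τ := by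
  simp only [bregmanInt]
  rw [← lintegral_const_mul' _ _ ENNReal.ofReal_ne_top,
    ← lintegral_const_mul' _ _ ENNReal.ofReal_ne_top,
    ← lintegral_const_mul' _ _ ENNReal.ofReal_ne_top,
    ← lintegral_add_left ((measurable_bregman_comp h u z).const_mul _),
    ← lintegral_add_left (measurable_bregman_comp h _ z)]
  refine lintegral_congr_ae ?_
  filter_upwards [ae_bregman_ne_top h hu, ae_bregman_ne_top h hx,
    Lp.coeFn_add ((1 - ε) • x) (ε • u), Lp.coeFn_smul (1 - ε) x, Lp.coeFn_smul ε u]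
    with θ h1 h2 h3 h4 h5
  rw [h3, Pi.add_apply, h4, h5]
  exact bregman_convex_comb h h1 h2 hε hε'

/-- Fatou's lemma for the convexity defects. -/
lemma bregmanInt_le_of_forall_convexityDefect_le (h : AssumptionA2 η) {u x : Lp ℝ 1 τ}
    (hu : ∀ᵐ θ ∂τ, u θ ∈ edom η) (hx : ∀ᵐ θ ∂τ, x θ ∈ edom η) {B : ℝ≥0∞}
    (hB : ∀ ε : ℝ, 0 < ε → ε < 1 → ∫⁻ θ, convexityDefect η ε (u θ) (x θ) ∂τ ≤ B) :
    bregmanInt η u x ≤ B := by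
  -- The second `+ 1` keeps ε 0 = 1/2 strictly below 1.
  set ε : ℕ → ℝ := fun n => 1 / ((n : ℝ) + 1 + 1) with hε
  have hε0 : ∀ n, 0 < ε n := fun n => by positivity
  have hε1 : ∀ n, ε n < 1 := fun n => by
    rw [hε, div_lt_one (by positivity)]
    linarith [(Nat.cast_nonneg n : (0 : ℝ) ≤ n)]
  have hlim : Tendsto ε atTop (nhdsWithin 0 (Ioi 0)) := by
    refine tendsto_nhdsWithin_iff.2 ⟨?_, Eventually.of_forall hε0⟩
    have := (tendsto_one_div_add_atTop_nhds_zero_nat (𝕜 := ℝ)).comp (tendsto_add_atTop_nat 1)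
    simpa [Function.comp_def, hε] using this
  calc bregmanInt η u x
      = ∫⁻ θ, liminf (fun n => convexityDefect η (ε n) (u θ) (x θ)) atTop ∂τ := by
        refine lintegral_congr_ae ?_
        filter_upwards [hu, hx] with θ h1 h2
        exact ((tendsto_convexityDefect h h1 h2).comp hlim).liminf_eq.symm
    _ ≤ liminf (fun n => ∫⁻ θ, convexityDefect η (ε n) (u θ) (x θ) ∂τ) atTop :=
        lintegral_liminf_le fun n => measurable_convexityDefect_comp h (ε n) u x
    _ ≤ B := liminf_le_of_le (by isBoundedDefault) fun b hb => by
        obtain ⟨n, hn⟩ := hb.exists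
        exact hn.trans (hB _ (hε0 n) (hε1 n))

end BregmanInt

/-! ### Three-point inequality -/

section ThreePoint

variable {Θ : Type*} [MeasurableSpace Θ] {τ : Measure Θ}
  {𝓕 : Type*} [NormedAddCommGroup 𝓕] [InnerProductSpace ℝ 𝓕] [CompleteSpace 𝓕]
  [TopologicalSpace Θ] [CompactSpace Θ] [TopologicalSpace.MetrizableSpace Θ] [BorelSpace Θ]
  {Φ : C(Θ, 𝓕)} {R : 𝓕 → ℝ} {Hbar : SignedMeasure Θ → ℝ≥0∞} {η : ℝ → ℝ≥0∞}

lemma stepObjective_eq {t : ℝ} (ht : 0 ≤ t) {g z f : Lp ℝ 1 τ} (hH : H Hbar f ≠ ⊤)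
    (hD : bregmanInt η f z ≠ ⊤) :
    stepObjective Φ R Hbar η t g z f =
      ((linearization Φ R g f + (H Hbar f).toReal + t * (bregmanInt η f z).toReal : ℝ) :
        EReal) := by
  rw [stepObjective, G_add_integral_GDeriv, ← ENNReal.ofReal_toReal hH,
    ← ENNReal.ofReal_toReal hD, ← ENNReal.ofReal_mul ht, EReal.coe_ennreal_ofReal,
    EReal.coe_ennreal_ofReal, max_eq_left (by positivity), max_eq_left (by positivity)]
  simp

lemma ne_top_of_stepObjective_ne_top {t : ℝ} (ht : 0 < t) {g z f : Lp ℝ 1 τ}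
    (hf : stepObjective Φ R Hbar η t g z f ≠ ⊤) : H Hbar f ≠ ⊤ ∧ bregmanInt η f z ≠ ⊤ := by
  constructor
  · intro hH
    refine hf ?_
    rw [stepObjective, hH, EReal.coe_ennreal_top, EReal.coe_add_top, EReal.top_add_of_ne_bot]
    exact EReal.coe_ennreal_ne_bot _
  · intro hD
    refine hf ?_
    rw [stepObjective, hD, ENNReal.mul_top (by simpa using ht), EReal.coe_ennreal_top,
      EReal.add_top_of_ne_bot]
    simp [EReal.add_eq_bot_iff]

/-- The three-point inequality for a Bregman proximal step. -/
theorem three_point (hA1 : AssumptionA1 R Hbar) (hA2 : AssumptionA2 η) {t : ℝ} (ht : 0 < t)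
    {g z x : Lp ℝ 1 τ} (hmin : IsMinOn (stepObjective Φ R Hbar η t g z) univ x)
    {u : Lp ℝ 1 τ} (hHu : H Hbar u ≠ ⊤) (hDu : bregmanInt η u z ≠ ⊤) :
    H Hbar x ≠ ⊤ ∧ bregmanInt η x z ≠ ⊤ ∧ bregmanInt η u x ≠ ⊤ ∧
      linearization Φ R g x + (H Hbar x).toReal + t * (bregmanInt η x z).toReal
          + t * (bregmanInt η u x).toReal
        ≤ linearization Φ R g u + (H Hbar u).toReal + t * (bregmanInt η u z).toReal := by
  have hxu := hmin (mem_univ u)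
  have hu_eq := stepObjective_eq (Φ := Φ) (R := R) (g := g) ht.le hHu hDu
  obtain ⟨hHx, hDx⟩ : H Hbar x ≠ ⊤ ∧ bregmanInt η x z ≠ ⊤ := by
    refine ne_top_of_stepObjective_ne_top (Φ := Φ) (R := R) (g := g) ht ?_
    refine ne_top_of_le_ne_top ?_ hxu
    rw [hu_eq]
    exact EReal.coe_ne_top _
  have hx_eq := stepObjective_eq (Φ := Φ) (R := R) (g := g) ht.le hHx hDx
  change stepObjective Φ R Hbar η t g z x ≤ _ at hxu
  rw [hx_eq, hu_eq, EReal.coe_le_coe_iff] at hxu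
  -- The value gap between u and x divided by t; the claim is D(u, x) ≤ B.
  set B : ℝ := (linearization Φ R g u + (H Hbar u).toReal + t * (bregmanInt η u z).toReal
    - (linearization Φ R g x + (H Hbar x).toReal + t * (bregmanInt η x z).toReal)) / t with hB
  have hB0 : 0 ≤ B := div_nonneg (sub_nonneg.2 hxu) ht.le
  have key : bregmanInt η u x ≤ ENNReal.ofReal B := by
    refine bregmanInt_le_of_forall_convexityDefect_le hA2
      ((ae_bregman_ne_top hA2 hDu).mono fun θ => mem_edom_of_bregman_ne_top)
      ((ae_bregman_ne_top hA2 hDx).mono fun θ => mem_edom_of_bregman_ne_top) fun ε hε hε' => ?_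
    have hε1 : 0 < 1 - ε := sub_pos.2 hε'
    have hHm := H_convex_comb hA1.regularizer x u hε1 hε (by ring)
    have hHm' : ENNReal.ofReal (1 - ε) * H Hbar x + ENNReal.ofReal ε * H Hbar u ≠ ⊤ := by finiteness
    have hDm := bregmanInt_convex_comb hA2 hDu hDx hε hε'
    have hDm' : ENNReal.ofReal ε * bregmanInt η u z
        + ENNReal.ofReal (1 - ε) * bregmanInt η x z ≠ ⊤ := by finiteness
    set m := (1 - ε) • x + ε • u with hm
    set I := ∫⁻ θ, convexityDefect η ε (u θ) (x θ) ∂τ with hI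
    have hD_top : bregmanInt η m z ≠ ⊤ :=
      ne_top_of_le_ne_top (hDm ▸ hDm') le_self_add
    have hεI_top : ENNReal.ofReal ε * I ≠ ⊤ := ne_top_of_le_ne_top (hDm ▸ hDm') le_add_self
    have hI_top : I ≠ ⊤ := fun h => hεI_top (by simp [h, ENNReal.mul_top, hε])
    have hH_top : H Hbar m ≠ ⊤ := ne_top_of_le_ne_top hHm' hHm
    have hle := hmin (mem_univ m)
    change stepObjective Φ R Hbar η t g z x ≤ _ at hle
    rw [hx_eq, stepObjective_eq ht.le hH_top hD_top, EReal.coe_le_coe_iff,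
      hm, linearization_convex_comb _ _ _ _ _ (by ring), ← hm] at hle
    have hHr := ENNReal.toReal_mono hHm' hHm
    rw [ENNReal.toReal_add (by finiteness) (by finiteness), ENNReal.toReal_mul,
      ENNReal.toReal_mul, ENNReal.toReal_ofReal hε.le, ENNReal.toReal_ofReal hε1.le] at hHr
    have hDr := congrArg ENNReal.toReal hDm
    rw [ENNReal.toReal_add (by finiteness) (by finiteness), ENNReal.toReal_add hD_top hεI_top,
      ENNReal.toReal_mul, ENNReal.toReal_mul, ENNReal.toReal_mul, ENNReal.toReal_ofReal hε.le,
      ENNReal.toReal_ofReal hε1.le] at hDr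
    rw [ENNReal.le_ofReal_iff_toReal_le hI_top hB0, hB, le_div_iff₀ ht]
    -- Minimality at m, convexity of H and the defect identity share the terms weighted by 1-ε;
    -- after cancellation every remaining term carries a factor ε.
    refine le_of_mul_le_mul_left ?_ hε
    have hDr' := congrArg (fun r => t * r) hDr
    simp only [mul_add] at hDr'
    linarith
  have hDux : bregmanInt η u x ≠ ⊤ := ne_top_of_le_ne_top ENNReal.ofReal_ne_top key
  refine ⟨hHx, hDx, hDux, ?_⟩
  rw [ENNReal.le_ofReal_iff_toReal_le hDux hB0, hB, le_div_iff₀ ht] at key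
  linarith

end ThreePoint

/-! ### Acceleration coefficients -/

section Coefficients

lemma gam_pos (k : ℕ) : 0 < gam k := by
  induction k with
  | zero => simp [gam]
  | succ k ih =>
    have : gam k ^ 2 < √(gam k ^ 4 + 4 * gam k ^ 2) := by
      apply Real.lt_sqrt_of_sq_lt
      nlinarith [pow_pos ih 2]
    rw [gam]
    linarith

/-- γ_{k+1} is the positive root of x² + γ_k² x - γ_k² = 0. -/
lemma gam_succ_sq (k : ℕ) : gam (k + 1) ^ 2 = (1 - gam (k + 1)) * gam k ^ 2 := by
  have := Real.sq_sqrt (show 0 ≤ gam k ^ 4 + 4 * gam k ^ 2 by positivity)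
  rw [gam]
  linear_combination (1 / 4) * this

lemma gam_le_one (k : ℕ) : gam k ≤ 1 := by
  cases k with
  | zero => simp [gam]
  | succ k =>
    have h1 : 0 ≤ (1 - gam (k + 1)) * gam k ^ 2 := by rw [← gam_succ_sq]; positivity
    linarith [nonneg_of_mul_nonneg_left h1 (pow_pos (gam_pos k) 2)]

lemma gam_le (k : ℕ) : gam k ≤ 2 / (k + 2) := by
  induction k with
  | zero => simp [gam]
  | succ k ih =>
    have hk : (0 : ℝ) ≤ k := Nat.cast_nonneg k
    by_contra! hlt
    push_cast at hlt
    rw [div_lt_iff₀ (by linarith)] at hlt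
    rw [le_div_iff₀ (by linarith)] at ih
    have h1 := gam_pos (k + 1)
    have h2 := gam_le_one (k + 1)
    have h3 : gam (k + 1) ^ 2 * ((k : ℝ) + 2) ^ 2 ≤ (1 - gam (k + 1)) * 4 := by
      rw [gam_succ_sq, mul_assoc, ← mul_pow]
      have := pow_le_pow_left₀ (by have := gam_pos k; positivity) ih 2
      nlinarith
    set c := gam (k + 1)
    set m : ℝ := (k : ℝ) + 2
    have hm : 2 ≤ m := by simp only [m]; linarith
    have hlt' : 2 < c * (m + 1) := by
      have : m + 1 = (k : ℝ) + 1 + 2 := by simp only [m]; ring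
      rwa [this]
    have h4 : (2 : ℝ) ^ 2 < (c * (m + 1)) ^ 2 := pow_lt_pow_left₀ hlt' (by norm_num) two_ne_zero
    have h5 : (c * m) ^ 2 * (m + 1) ^ 2 ≤ (1 - c) * 4 * (m + 1) ^ 2 := by
      rw [mul_pow]; gcongr
    have h6 : 4 * m ^ 2 < (c * m) ^ 2 * (m + 1) ^ 2 := by
      have := mul_lt_mul_of_pos_right h4 (show 0 < m ^ 2 by positivity)
      linarith
    -- Combining `h5`, `h6` and c(m+1)² > 2(m+1) gives m² < m² - 1.
    nlinarith [mul_lt_mul_of_pos_right hlt' (show 0 < m + 1 by linarith)]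

end Coefficients

/-! ### Ingredients common to both methods -/

section Steps

variable {Θ : Type*} [MeasurableSpace Θ] {τ : Measure Θ}
  {𝓕 : Type*} [NormedAddCommGroup 𝓕] [InnerProductSpace ℝ 𝓕] [CompleteSpace 𝓕]
  [TopologicalSpace Θ] [CompactSpace Θ] [TopologicalSpace.MetrizableSpace Θ] [BorelSpace Θ]
  {Φ : C(Θ, 𝓕)} {R : 𝓕 → ℝ} {Hbar : SignedMeasure Θ → ℝ≥0∞} {η : ℝ → ℝ≥0∞}

/-- The objective as a real number, meaningful where `H` is finite. -/
def objective (Φ : C(Θ, 𝓕)) (R : 𝓕 → ℝ) (Hbar : SignedMeasure Θ → ℝ≥0∞) (f : Lp ℝ 1 τ) : ℝ :=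
  G Φ R f + (H Hbar f).toReal

lemma F_eq {f : Lp ℝ 1 τ} (hf : H Hbar f ≠ ⊤) : F Φ R Hbar f = (objective Φ R Hbar f : EReal) := by
  rw [objective, EReal.coe_add]
  change (G Φ R f : EReal) + (H Hbar f : EReal) = _
  rw [← ENNReal.ofReal_toReal hf, EReal.coe_ennreal_ofReal, max_eq_left (by positivity)]
  simp

lemma F_le_of_objective_le {f u f₀ : Lp ℝ 1 τ} {α : ℝ} (hα : 0 < α) (hf : H Hbar f ≠ ⊤)
    (h : H Hbar u ≠ ⊤ → bregmanInt η u f₀ ≠ ⊤ →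
      objective Φ R Hbar f ≤ objective Φ R Hbar u + α * (bregmanInt η u f₀).toReal) :
    F Φ R Hbar f ≤ F Φ R Hbar u
      + ((ENNReal.ofReal α * bregmanInt η u f₀ : ℝ≥0∞) : EReal) := by
  by_cases hu : H Hbar u = ⊤
  · have : F Φ R Hbar u = ⊤ := by
      change (G Φ R u : EReal) + (H Hbar u : EReal) = _
      rw [hu, EReal.coe_ennreal_top, EReal.coe_add_top]
    rw [this, EReal.top_add_of_ne_bot (EReal.coe_ennreal_ne_bot _)]
    exact le_top
  rw [F_eq hf, F_eq hu]
  by_cases hD : bregmanInt η u f₀ = ⊤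
  · rw [hD, ENNReal.mul_top (by simpa using hα), EReal.coe_ennreal_top, EReal.coe_add_top]
    exact le_top
  · have h := h hu hD
    rw [← ENNReal.ofReal_toReal hD, ← ENNReal.ofReal_mul hα.le, EReal.coe_ennreal_ofReal,
      max_eq_left (by positivity)]
    exact_mod_cast h

lemma H_convex_comb_ne_top (hR : IsRegularizer Hbar) {f g : Lp ℝ 1 τ} (hf : H Hbar f ≠ ⊤)
    (hg : H Hbar g ≠ ⊤) {c : ℝ} (hc : 0 < c) (hc' : c ≤ 1) :
    H Hbar ((1 - c) • f + c • g) ≠ ⊤ ∧ (H Hbar ((1 - c) • f + c • g)).toReal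
      ≤ (1 - c) * (H Hbar f).toReal + c * (H Hbar g).toReal := by
  rcases hc'.eq_or_lt with rfl | hlt
  · simp [hg]
  have hc1 : 0 < 1 - c := sub_pos.2 hlt
  have h := H_convex_comb hR f g hc1 hc (by ring)
  have htop : ENNReal.ofReal (1 - c) * H Hbar f + ENNReal.ofReal c * H Hbar g ≠ ⊤ := by finiteness
  refine ⟨ne_top_of_le_ne_top htop h, ?_⟩
  have h' := ENNReal.toReal_mono htop h
  rwa [ENNReal.toReal_add (by finiteness) (by finiteness), ENNReal.toReal_mul,
    ENNReal.toReal_mul, ENNReal.toReal_ofReal hc.le, ENNReal.toReal_ofReal hc1.le] at h'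

/-- Where g leaves the interior, a finite divergence forces g = f, which lies in the interior. -/
lemma ae_mem_interior_of_bregmanInt_ne_top (hA2 : AssumptionA2 η) {f g : Lp ℝ 1 τ}
    (hf : ∀ᵐ θ ∂τ, f θ ∈ interior (edom η)) (h : bregmanInt η f g ≠ ⊤) :
    ∀ᵐ θ ∂τ, g θ ∈ interior (edom η) := by
  filter_upwards [hf, ae_bregman_ne_top hA2 h] with θ h1 h2
  by_contra h3
  exact h3 (eq_of_bregman_ne_top h2 h3 ▸ h1)

lemma sq_norm_sub_le_bregmanInt {p : ℝ} {β K : ℝ≥0} (hη : StronglyConvexDiv τ η p β) {s : ℝ}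
    (hs : 0 < s) (hsK : ENNReal.ofReal s ≤
      ((K + β : ℝ≥0) : ℝ≥0∞) ^ (p - 2) * (‖Φ‖ₑ ^ 2 * (lipConst (gradient R) : ℝ≥0∞))⁻¹)
    {f g : Lp ℝ 1 τ} (hf : ‖f‖ ≤ K) (hg : ‖g‖ ≤ K) (hgi : ∀ᵐ θ ∂τ, g θ ∈ interior (edom η))
    (hD : bregmanInt η f g ≠ ⊤) :
    ‖Φ‖ ^ 2 * lipConst (gradient R) / 2 * ‖f - g‖ ^ 2 ≤ 1 / s * (bregmanInt η f g).toReal := by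
  have h := hη K f g hf hg hgi
  set A := ((K + β : ℝ≥0) : ℝ≥0∞) ^ (p - 2)
  set B := ‖Φ‖ₑ ^ 2 * (lipConst (gradient R) : ℝ≥0∞) with hB
  have hAB : ENNReal.ofReal s * B ≤ A := by
    calc ENNReal.ofReal s * B ≤ A * B⁻¹ * B := by gcongr
      _ = A * (B⁻¹ * B) := mul_assoc _ _ _
      -- Valid for B = 0 and B = ⊤ too, so degenerate step-size bounds need no separate case.
      _ ≤ A * 1 := by gcongr; exact ENNReal.inv_mul_le_one B
      _ = A := mul_one A
  have h' : ENNReal.ofReal s * B / 2 * ‖f - g‖ₑ ^ 2 ≤ bregmanInt η f g :=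
    le_trans (by gcongr) h
  have h'' := ENNReal.toReal_mono hD h'
  simp only [hB, ENNReal.toReal_mul, ENNReal.toReal_div, ENNReal.toReal_pow, toReal_enorm,
    ENNReal.toReal_ofReal hs.le, ENNReal.coe_toReal, ENNReal.toReal_ofNat] at h''
  rw [one_div_mul_eq_div, le_div_iff₀ hs]
  linarith

end Steps

/-! ### Convergence rates -/

section Rates

variable {Θ : Type*} [TopologicalSpace Θ] [CompactSpace Θ] [TopologicalSpace.MetrizableSpace Θ]
  [MeasurableSpace Θ] [BorelSpace Θ] {τ : Measure Θ}
  {𝓕 : Type*} [NormedAddCommGroup 𝓕] [InnerProductSpace ℝ 𝓕] [CompleteSpace 𝓕]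
  {Φ : C(Θ, 𝓕)} {R : 𝓕 → ℝ} {Hbar : SignedMeasure Θ → ℝ≥0∞} {η : ℝ → ℝ≥0∞}
  {p : ℝ} {β K : ℝ≥0} {f₀ : Lp ℝ 1 τ} {s : ℝ}

theorem IsPGM.rate (hA1 : AssumptionA1 R Hbar) (hA2 : AssumptionA2 η)
    (hη : StronglyConvexDiv τ η p β) (hf₀ : H Hbar f₀ ≠ ⊤)
    (hηf₀ : ∀ᵐ θ ∂τ, f₀ θ ∈ interior (edom η)) (hs : 0 < s)
    (hsK : ENNReal.ofReal s ≤
      ((K + β : ℝ≥0) : ℝ≥0∞) ^ (p - 2) * (‖Φ‖ₑ ^ 2 * (lipConst (gradient R) : ℝ≥0∞))⁻¹)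
    {f : ℕ → Lp ℝ 1 τ} (hf : IsPGM Φ R Hbar η s f₀ f) (hfK : ∀ k, ‖f k‖ ≤ K)
    (u : Lp ℝ 1 τ) (k : ℕ) (hk : 1 ≤ k) :
    F Φ R Hbar (f k) ≤ F Φ R Hbar u
      + ((ENNReal.ofReal (1 / (s * k)) * bregmanInt η u f₀ : ℝ≥0∞) : EReal) := by
  have hs' : 0 < 1 / s := one_div_pos.2 hs
  -- Three-point inequality with u = f₀: finiteness of D(f₀, f_k) passes to the next iterate.
  have hinv : ∀ k, H Hbar (f k) ≠ ⊤ ∧ bregmanInt η f₀ (f k) ≠ ⊤ := by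
    intro k
    induction k with
    | zero =>
      rw [hf.init, bregmanInt_self (hηf₀.mono fun θ h => interior_subset h)]
      exact ⟨hf₀, ENNReal.zero_ne_top⟩
    | succ k ih =>
      obtain ⟨h1, -, h2, -⟩ := three_point hA1 hA2 hs' (hf.step k) hf₀ ih.2
      exact ⟨h1, h2⟩
  have hint : ∀ k, ∀ᵐ θ ∂τ, f k θ ∈ interior (edom η) := fun k =>
    ae_mem_interior_of_bregmanInt_ne_top hA2 hηf₀ (hinv k).2
  have hstep : ∀ (k : ℕ) (v : Lp ℝ 1 τ), H Hbar v ≠ ⊤ → bregmanInt η v (f k) ≠ ⊤ →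
      bregmanInt η v (f (k + 1)) ≠ ⊤ ∧
        objective Φ R Hbar (f (k + 1)) + 1 / s * (bregmanInt η v (f (k + 1))).toReal
          ≤ objective Φ R Hbar v + 1 / s * (bregmanInt η v (f k)).toReal := by
    intro k v hHv hDv
    obtain ⟨-, h2, h3, h4⟩ := three_point hA1 hA2 hs' (hf.step k) hHv hDv
    refine ⟨h3, ?_⟩
    have h5 := G_le_linearization Φ hA1.differentiable hA1.lipschitz (f k) (f (k + 1))
    have h6 := sq_norm_sub_le_bregmanInt hη hs hsK (hfK (k + 1)) (hfK k) (hint k) h2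
    have h7 := linearization_le Φ hA1.convex hA1.differentiable (f k) v
    rw [objective, objective]
    linarith
  have hdecr : ∀ k, objective Φ R Hbar (f (k + 1)) ≤ objective Φ R Hbar (f k) := by
    intro k
    have h0 : bregmanInt η (f k) (f k) = 0 :=
      bregmanInt_self ((hint k).mono fun θ h => interior_subset h)
    have h1 := (hstep k (f k) (hinv k).1 (by simp [h0])).2
    rw [h0, ENNReal.toReal_zero, mul_zero, add_zero] at h1
    have : 0 ≤ 1 / s * (bregmanInt η (f k) (f (k + 1))).toReal := by positivity
    linarith
  have hk0 : (0 : ℝ) < k := by exact_mod_cast hk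
  refine F_le_of_objective_le (by positivity) (hinv k).1 fun hHu hDu => ?_
  -- Telescoped sum of the one-step bounds, with every past objective value replaced by the latest,
  -- smallest one.
  have hsum : ∀ k : ℕ, bregmanInt η u (f k) ≠ ⊤ ∧
      k * objective Φ R Hbar (f k) + 1 / s * (bregmanInt η u (f k)).toReal
        ≤ k * objective Φ R Hbar u + 1 / s * (bregmanInt η u f₀).toReal := by
    intro k
    induction k with
    | zero => simp [hf.init, hDu]
    | succ k ih =>
      obtain ⟨h1, h2⟩ := hstep k u hHu ih.1
      refine ⟨h1, ?_⟩
      have h3 := mul_le_mul_of_nonneg_left (hdecr k) (Nat.cast_nonneg (α := ℝ) k)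
      push_cast
      linarith [ih.2]
  have h1 := (hsum k).2
  have h2 : 0 ≤ 1 / s * (bregmanInt η u (f k)).toReal := by positivity
  refine le_of_mul_le_mul_left (a := (k : ℝ)) ?_ hk0
  have h3 : (k : ℝ) * (objective Φ R Hbar u + 1 / (s * k) * (bregmanInt η u f₀).toReal)
      = k * objective Φ R Hbar u + 1 / s * (bregmanInt η u f₀).toReal := by field_simp
  rw [h3]
  linarith

theorem IsAPGM.rate (hA1 : AssumptionA1 R Hbar) (hA2 : AssumptionA2 η)
    (hη : StronglyConvexDiv τ η p β) (hf₀ : H Hbar f₀ ≠ ⊤)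
    (hηf₀ : ∀ᵐ θ ∂τ, f₀ θ ∈ interior (edom η)) (hs : 0 < s)
    (hsK : ENNReal.ofReal s ≤
      ((K + β : ℝ≥0) : ℝ≥0∞) ^ (p - 2) * (‖Φ‖ₑ ^ 2 * (lipConst (gradient R) : ℝ≥0∞))⁻¹)
    {f g h : ℕ → Lp ℝ 1 τ} (hfgh : IsAPGM Φ R Hbar η s f₀ f g h) (hhK : ∀ k, ‖h k‖ ≤ K)
    (u : Lp ℝ 1 τ) (k : ℕ) (hk : 1 ≤ k) :
    F Φ R Hbar (f k) ≤ F Φ R Hbar u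
      + ((ENNReal.ofReal (4 / (s * (k + 1) ^ 2)) * bregmanInt η u f₀ : ℝ≥0∞) : EReal) := by
  have ht : ∀ k, 0 < gam k / s := fun k => div_pos (gam_pos k) hs
  have hinv : ∀ k, H Hbar (h k) ≠ ⊤ ∧ bregmanInt η f₀ (h k) ≠ ⊤ := by
    intro k
    induction k with
    | zero =>
      rw [hfgh.init_h, bregmanInt_self (hηf₀.mono fun θ h => interior_subset h)]
      exact ⟨hf₀, ENNReal.zero_ne_top⟩
    | succ k ih =>
      obtain ⟨h1, -, h2, -⟩ := three_point hA1 hA2 (ht k) (hfgh.step_h k) hf₀ ih.2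
      exact ⟨h1, h2⟩
  have hHf : ∀ k, H Hbar (f k) ≠ ⊤ := by
    intro k
    induction k with
    | zero => rwa [hfgh.init_f]
    | succ k ih =>
      rw [hfgh.step_f]
      exact (H_convex_comb_ne_top hA1.regularizer ih (hinv (k + 1)).1 (gam_pos k)
        (gam_le_one k)).1
  have hint : ∀ k, ∀ᵐ θ ∂τ, h k θ ∈ interior (edom η) := fun k =>
    ae_mem_interior_of_bregmanInt_ne_top hA2 hηf₀ (hinv k).2
  have hstep : ∀ (k : ℕ) (v : Lp ℝ 1 τ), H Hbar v ≠ ⊤ → bregmanInt η v (h k) ≠ ⊤ →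
      bregmanInt η v (h (k + 1)) ≠ ⊤ ∧
        objective Φ R Hbar (f (k + 1)) + gam k ^ 2 / s * (bregmanInt η v (h (k + 1))).toReal
          ≤ (1 - gam k) * objective Φ R Hbar (f k) + gam k * objective Φ R Hbar v
            + gam k ^ 2 / s * (bregmanInt η v (h k)).toReal := by
    intro k v hHv hDv
    obtain ⟨-, h2, h3, h4⟩ := three_point hA1 hA2 (ht k) (hfgh.step_h k) hHv hDv
    refine ⟨h3, ?_⟩
    have hγ := gam_pos k
    have hγ1 : 0 ≤ 1 - gam k := sub_nonneg.2 (gam_le_one k)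
    have h5 := G_le_linearization Φ hA1.differentiable hA1.lipschitz (g k) (f (k + 1))
    -- The key of acceleration: the quadratic error gains a factor γ_k², matching γ_k · (γ_k/s) in
    -- front of the divergence. Only the h_k enter it, so bounding their norms suffices.
    have hsub : f (k + 1) - g k = gam k • (h (k + 1) - h k) := by
      rw [hfgh.step_f, hfgh.step_g, smul_sub]
      abel
    have hlin : linearization Φ R (g k) (f (k + 1)) = (1 - gam k) * linearization Φ R (g k) (f k)
        + gam k * linearization Φ R (g k) (h (k + 1)) := by
      rw [hfgh.step_f, linearization_convex_comb _ _ _ _ _ (by ring)]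
    rw [hsub, norm_smul, Real.norm_of_nonneg hγ.le, hlin] at h5
    have h6 := mul_le_mul_of_nonneg_left
      (sq_norm_sub_le_bregmanInt hη hs hsK (hhK (k + 1)) (hhK k) (hint k) h2) (sq_nonneg (gam k))
    have h7 := mul_le_mul_of_nonneg_left
      (linearization_le Φ hA1.convex hA1.differentiable (g k) v) hγ.le
    have h8 := mul_le_mul_of_nonneg_left
      (linearization_le Φ hA1.convex hA1.differentiable (g k) (f k)) hγ1
    have h9 := (H_convex_comb_ne_top hA1.regularizer (hHf k) (hinv (k + 1)).1 (gam_pos k)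
        (gam_le_one k)).2
    rw [← hfgh.step_f] at h9
    have h10 := mul_le_mul_of_nonneg_left h4 hγ.le
    have e : ∀ r : ℝ, gam k * (gam k / s * r) = gam k ^ 2 / s * r := fun r => by ring
    have e' : ∀ r : ℝ, gam k ^ 2 * (1 / s * r) = gam k ^ 2 / s * r := fun r => by ring
    simp only [mul_add, e] at h10
    rw [e'] at h6
    simp only [objective]
    linarith
  refine F_le_of_objective_le (by positivity) (hHf k) fun hHu hDu => ?_
  -- Starts at index 1 because γ_0 = 1 removes the initial objective gap.
  have hsum : ∀ k : ℕ, bregmanInt η u (h (k + 1)) ≠ ⊤ ∧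
      objective Φ R Hbar (f (k + 1)) - objective Φ R Hbar u
          + gam k ^ 2 / s * (bregmanInt η u (h (k + 1))).toReal
        ≤ gam k ^ 2 / s * (bregmanInt η u f₀).toReal := by
    intro k
    induction k with
    | zero =>
      obtain ⟨h1, h2⟩ := hstep 0 u hHu (by rwa [hfgh.init_h])
      refine ⟨h1, ?_⟩
      rw [hfgh.init_h] at h2
      simp only [gam, sub_self, zero_mul, zero_add, one_mul] at h2 ⊢
      linarith
    | succ k ih =>
      obtain ⟨h1, h2⟩ := hstep (k + 1) u hHu ih.1
      refine ⟨h1, ?_⟩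
      have h3 := mul_le_mul_of_nonneg_left ih.2 (sub_nonneg.2 (gam_le_one (k + 1)))
      have e : ∀ r : ℝ, (1 - gam (k + 1)) * (gam k ^ 2 / s * r) = gam (k + 1) ^ 2 / s * r :=
        fun r => by rw [gam_succ_sq]; ring
      rw [mul_add, e, e] at h3
      linarith
  obtain ⟨j, rfl⟩ := Nat.exists_eq_add_of_le' hk
  have h1 := (hsum j).2
  have h2 : 0 ≤ gam j ^ 2 / s * (bregmanInt η u (h (j + 1))).toReal := by positivity
  -- Here k = j + 1, so γ_j ≤ 2/(j+2) is 2/(k+1).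
  have h3 : gam j ^ 2 / s ≤ 4 / (s * (((j + 1 : ℕ) : ℝ) + 1) ^ 2) := by
    have := pow_le_pow_left₀ (gam_pos j).le (gam_le j) 2
    calc gam j ^ 2 / s ≤ (2 / ((j : ℝ) + 2)) ^ 2 / s := by gcongr
      _ = 4 / (s * (((j + 1 : ℕ) : ℝ) + 1) ^ 2) := by
        push_cast
        field_simp
        ring
  have h4 := mul_le_mul_of_nonneg_right h3 (bregmanInt η u f₀).toReal_nonneg
  linarith

end Rates

end BregmanMethods

end

theorem mainTheorem5
    {Θ : Type*} [TopologicalSpace Θ] [CompactSpace Θ] [TopologicalSpace.MetrizableSpace Θ]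
    [MeasurableSpace Θ] [BorelSpace Θ] (τ : Measure Θ) [IsProbabilityMeasure τ]
    {𝓕 : Type*} [NormedAddCommGroup 𝓕] [InnerProductSpace ℝ 𝓕] [CompleteSpace 𝓕]
    (Φ : C(Θ, 𝓕)) (R : 𝓕 → ℝ) (Hbar : SignedMeasure Θ → ℝ≥0∞) (hA1 : AssumptionA1 R Hbar)
    (η : ℝ → ℝ≥0∞) (hA2 : AssumptionA2 η)
    (p : ℝ) (hp : p ∈ Set.Icc (1 : ℝ) 2) (β : ℝ≥0) (hη : StronglyConvexDiv τ η p β)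
    (f₀ : Lp ℝ 1 τ) (hf₀ : f₀ ∈ edom (H (τ := τ) Hbar)) (hηf₀ : EtaDerivBounded η f₀)
    (K : ℝ≥0) (hK : ‖f₀‖ ≤ K) (s : ℝ) (hs : 0 < s)
    (hsK : ENNReal.ofReal s ≤
      ((K + β : ℝ≥0) : ℝ≥0∞) ^ (p - 2) * (‖Φ‖ₑ ^ 2 * (lipConst (gradient R) : ℝ≥0∞))⁻¹) :
    (∀ f : ℕ → Lp ℝ 1 τ, IsPGM Φ R Hbar η s f₀ f → (∀ k, ‖f k‖ ≤ K) →
      ∀ (u : Lp ℝ 1 τ) (k : ℕ), 1 ≤ k →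
        F Φ R Hbar (f k) ≤ F Φ R Hbar u
          + ((ENNReal.ofReal (1 / (s * k)) * bregmanInt η u f₀ : ℝ≥0∞) : EReal)) ∧
    (∀ f g h : ℕ → Lp ℝ 1 τ, IsAPGM Φ R Hbar η s f₀ f g h → (∀ k, ‖h k‖ ≤ K) →
      ∀ (u : Lp ℝ 1 τ) (k : ℕ), 1 ≤ k →
        F Φ R Hbar (f k) ≤ F Φ R Hbar u
          + ((ENNReal.ofReal (4 / (s * (k + 1) ^ 2)) * bregmanInt η u f₀ : ℝ≥0∞) : EReal)) ∧
    (∀ k : ℕ, 0 < gam k ∧ gam k ≤ 1 ∧ gam k ≤ 2 / (k + 2)) := by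
  have hint := hηf₀.1
  exact ⟨fun f hf hfK u k hk => hf.rate hA1 hA2 hη hf₀.ne hint hs hsK hfK u k hk,
    fun f g h hfgh hhK u k hk => hfgh.rate hA1 hA2 hη hf₀.ne hint hs hsK hhK u k hk,
    fun k => ⟨gam_pos k, gam_le_one k, gam_le k⟩⟩
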